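/- Let $a>0$, $c\in\mathbb{R}$, $p\in\{1,2\}$, and $\mathbb{H}_a=\{(r,\theta): r>0,\ |\theta|<a\}$. A function $f:\mathbb{H}_a\to\mathbb{C}$ is called polar-analytic if for every $(r_0,\theta_0)\in\mathbb{H}_a$ the limit $$\lim_{(r,\theta)\to(r_0,\theta_0)}\frac{f(r,\theta)-f(r_0,\theta_0)}{re^{i\theta}-r_0e^{i\theta_0}}$$ exists in $\mathbb{C}$. For $\varphi:\mathbb{R}^+\to\mathbb{C}$ write $\varphi\in X^p_c$ if $r\mapsto r^{c-1/p}\varphi(r)$ belongs to $L^p(\mathbb{R}^+)$, with $\|\varphi\|_{X^p_c}=\big(\int_0^\infty|\varphi(r)|^pr^{cp-1}\,dr\big)^{1/p}$. The Mellin transform of $\varphi\in X^1_c$ is $[\varphi]^\wedge_{M^1_c}(c+it)=\int_0^\infty u^{c+it-1}\varphi(u)\,du$ for $t\in\mathbb{R}$; the Mellin transform $[\varphi]^\wedge_{M^2_c}(c+i\,\cdot)$ of $\varphi\in X^2_c$ is the limit in $L^2(\mathbb{R})$, as $\rho\to+\infty$, of the functions $t\mapsto\int_{1/\rho}^{\rho}u^{c+it-1}\varphi(u)\,du$.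 The Mellin–Hardy space $H^p_c(\mathbb{H}_a)$ consists of all polar-analytic $f:\mathbb{H}_a\to\mathbb{C}$ with $f(\cdot,\theta)\in X^p_c$ for every $\theta\in\,]-a,a[$ and $$\sup_{0<\theta<a}\Big(\tfrac12\|f(\cdot,\theta)\|^p_{X^p_c}+\tfrac12\|f(\cdot,-\theta)\|^p_{X^p_c}\Big)^{1/p}<+\infty.$$ **Theorem.** Let $f\in H^p_c(\mathbb{H}_a)$ and $\alpha\in\,]0,a[$. Then the Mellin transforms $[f(\cdot,\theta)]^\wedge_{M^p_c}$ exist for all $\theta\in\,]-a,a[$, and for almost every $t\in\mathbb{R}$ $$\big|[f(\cdot,0)]^\wedge_{M^p_c}(c+it)\big|=e^{-\alpha|t|}\,\big|[f(\cdot,\varepsilon\alpha)]^\wedge_{M^p_c}(c+it)\big|,$$ where $\varepsilon=1$ for $t>0$ and $\varepsilon=-1$ for $t<0$. -/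

import Mathlib

open Set Filter Topology MeasureTheory
open scoped ENNReal

noncomputable section

namespace MellinHardy

/-- The strip `ℍ_a = {(r, θ) : r > 0, -a < θ < a}` of the right half-plane `ℍ` of polar
coordinates (no identification of angles modulo `2π` is made). -/
def strip (a : ℝ) : Set (ℝ × ℝ) := Ioi (0 : ℝ) ×ˢ Ioo (-a) a

/-- The complex number `r e^{iθ}` with polar coordinates `q = (r, θ)`. -/
def polar (q : ℝ × ℝ) : ℂ := (q.1 : ℂ) * Complex.exp ((q.2 : ℂ) * Complex.I)

/-- `f` is polar-analytic on `D`: at every `q₀ ∈ D` the quotient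
`(f q - f q₀) / (r e^{iθ} - r₀ e^{iθ₀})` has a limit as `q = (r, θ) → q₀ = (r₀, θ₀)` within `D`,
`q ≠ q₀`. -/
def PolarAnalyticOn (f : ℝ × ℝ → ℂ) (D : Set (ℝ × ℝ)) : Prop :=
  ∀ q₀ ∈ D, ∃ L : ℂ,
    Tendsto (fun q : ℝ × ℝ => (f q - f q₀) / (polar q - polar q₀)) (𝓝[D \ {q₀}] q₀) (𝓝 L)

/-- The function `r ↦ r^{c - 1/p} φ(r)`. -/
def weighted (p c : ℝ) (φ : ℝ → ℂ) (r : ℝ) : ℂ := ((r ^ (c - 1 / p) : ℝ) : ℂ) * φ r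

/-- `φ ∈ X^p_c`, that is `r ↦ r^{c - 1/p} φ(r)` belongs to `L^p(ℝ⁺)`. Only the values of `φ` on
`ℝ⁺` matter. -/
def MemX (p c : ℝ) (φ : ℝ → ℂ) : Prop :=
  MemLp (weighted p c φ) (ENNReal.ofReal p) (volume.restrict (Ioi (0 : ℝ)))

/-- The norm of `X^p_c`, with values in `[0, ∞]`:
`‖r^{c - 1/p} φ(r)‖_{L^p(ℝ⁺)} = (∫₀^∞ |φ(r)|^p r^{cp-1} dr)^{1/p}`. -/
def normX (p c : ℝ) (φ : ℝ → ℂ) : ℝ≥0∞ :=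
  eLpNorm (weighted p c φ) (ENNReal.ofReal p) (volume.restrict (Ioi (0 : ℝ)))

/-- The norm of `H^p_c(ℍ_a)`, with values in `[0, ∞]`. -/
def hardyNorm (p c a : ℝ) (f : ℝ × ℝ → ℂ) : ℝ≥0∞ :=
  ⨆ θ ∈ Ioo (0 : ℝ) a,
    ((normX p c (fun r => f (r, θ)) ^ p + normX p c (fun r => f (r, -θ)) ^ p) / 2) ^ (1 / p)

/-- Membership in the Mellin–Hardy space `H^p_c(ℍ_a)`. Only the values of `f` on the strip `ℍ_a`
matter. -/
structure MemHardy (p c a : ℝ) (f : ℝ × ℝ → ℂ) : Prop where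
  polarAnalytic : PolarAnalyticOn f (strip a)
  memX : ∀ θ ∈ Ioo (-a) a, MemX p c (fun r => f (r, θ))
  norm_lt_top : hardyNorm p c a f < ⊤

/-- The truncated Mellin integral `∫_{1/ρ}^ρ u^{c+it-1} φ(u) du`. -/
def truncMellin (c : ℝ) (φ : ℝ → ℂ) (ρ t : ℝ) : ℂ :=
  ∫ u in (1 / ρ)..ρ, (u : ℂ) ^ ((c : ℂ) + (t : ℂ) * Complex.I - 1) * φ u

/-- `t ↦ G t` is (a version of) the Mellin transform `t ↦ M^p_c[φ](c + it)`, `1 ≤ p ≤ 2`.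
For `p = 1` it is the absolutely convergent integral `∫₀^∞ u^{c+it-1} φ(u) du`; for `1 < p ≤ 2`
it is the limit in the mean of order `p' = p / (p - 1)` of the truncated Mellin integrals. -/
def IsMellinTransform (p c : ℝ) (φ : ℝ → ℂ) (G : ℝ → ℂ) : Prop :=
  if p = 1 then
    ∀ t : ℝ, MellinConvergent φ ((c : ℂ) + (t : ℂ) * Complex.I) ∧
      G t = mellin φ ((c : ℂ) + (t : ℂ) * Complex.I)
  else
    MemLp G (ENNReal.ofReal (p / (p - 1))) volume ∧
      Tendsto (fun ρ : ℝ =>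
        eLpNorm (fun t => G t - truncMellin c φ ρ t) (ENNReal.ofReal (p / (p - 1))) volume)
        atTop (𝓝 0)

/-- The Mellin transform `t ↦ M^p_c[φ](c + it)`: a function with `IsMellinTransform` (unique for
`p = 1`, unique up to null sets for `1 < p ≤ 2`) whenever there is one. -/
def mellinTransform (p c : ℝ) (φ : ℝ → ℂ) : ℝ → ℂ :=
  Classical.epsilon (IsMellinTransform p c φ)

end MellinHardy

end

/-! In the coordinate `z = log r + iθ` polar-analyticity becomes holomorphy on the strip `|Im z| <
a`. Put `H z = e^{cz} f(e^{Re z}, Im z)`. Since `|H(x + iy)| = e^{cx} |f(e^x, y)|`, the `X^p_c` norm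
of a slice is the `L^p` norm of `H` on a horizontal line, and the Mellin transform of the slice at
`c + it` is, up to a phase, the integral of `e^{itx} H(x + iθ)`.

Cauchy's theorem for `e^{itz} H(z)` on `[-R, R] × [0, θ]` compares the lines of height `0` and `θ`
(`tendsto_integral_sub_integral_shift`). By Tonelli the uniform `L^p` bound makes the vertical
`p`-means integrable in `x`, so the vertical sides vanish along some `R n → ∞`
(`exists_seq_tendsto_vertical_lintegral`). The truncated transforms converge almost everywhere along
a further subsequence, whence `G₀ t = e^{(ic - t)θ} G t` (`MemHardy.ae_mellin_zero_eq`). Take moduli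
with `θ = α` for `t > 0` and `θ = -α` for `t < 0`. -/

namespace MellinHardy

/-! ### Plancherel theory for truncated Fourier integrals. -/

section Plancherel

open scoped FourierTransform SchwartzMap ContDiff

/-- On `L¹ ∩ L²` the `L²` Fourier transform is given by the Fourier integral. -/
theorem fourier_toLp_ae_eq {h : ℝ → ℂ} (h1 : Integrable h) (h2 : MemLp h 2) :
    (𝓕 (h2.toLp h) : Lp ℂ 2 (volume : Measure ℝ)) =ᵐ[volume] 𝓕 h := by
  -- Test against smooth compactly supported `g`: both transforms can be moved onto `g`, one as
  -- tempered distributions, the other by Fubini.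
  refine ae_eq_of_integral_contDiff_smul_eq
    ((Lp.memLp _).locallyIntegrable (by norm_num)) ?_ fun g hg hgc => ?_
  · exact (VectorFourier.fourierIntegral_continuous Real.continuous_fourierChar
      (L := innerₗ ℝ) continuous_inner h1).locallyIntegrable
  · have hg' : ContDiff ℝ ∞ (fun x => (g x : ℂ)) := Complex.ofRealCLM.contDiff.comp hg
    have hgc' : HasCompactSupport (fun x => (g x : ℂ)) :=
      hgc.comp_left (g := fun x : ℝ => (x : ℂ)) (by simp)
    set G : 𝓢(ℝ, ℂ) := hgc'.toSchwartzMap hg' with hG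
    have key := congrArg (fun T => T G) (Lp.fourier_toTemperedDistribution_eq (h2.toLp h))
    simp only [TemperedDistribution.fourier_apply, Lp.toTemperedDistribution_apply] at key
    have e1 : ∫ x, (𝓕 G) x • (h2.toLp h) x = ∫ x, (𝓕 G) x • h x := by
      refine integral_congr_ae ?_
      filter_upwards [h2.coeFn_toLp] with x hx
      rw [hx]
    have e2 : ∫ x, (𝓕 G) x • h x = ∫ x, G x • 𝓕 h x := by
      simpa using! VectorFourier.integral_bilin_fourierIntegral_eq_flip (.lsmul ℂ ℂ)
        (L := innerₗ ℝ) Real.continuous_fourierChar continuous_inner G.integrable h1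
    rw [e1, e2] at key
    exact key.symm

theorem tendsto_eLpNorm_indicator_sub {ψ : ℝ → ℂ} (h : MemLp ψ 2) :
    Tendsto (fun R : ℝ => eLpNorm ((Ioc (-R) R).indicator ψ - ψ) 2 volume) atTop (𝓝 0) := by
  have hne : (2 : ℝ≥0∞) ≠ 0 := by norm_num
  have hnt : (2 : ℝ≥0∞) ≠ ⊤ := by norm_num
  simp only [eLpNorm_eq_lintegral_rpow_enorm_toReal hne hnt]
  have hlim : Tendsto (fun R : ℝ => ∫⁻ x, ‖((Ioc (-R) R).indicator ψ - ψ) x‖ₑ ^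
      (2 : ℝ≥0∞).toReal) atTop (𝓝 (∫⁻ _ : ℝ, 0)) := by
    refine tendsto_lintegral_filter_of_dominated_convergence'
      (fun x => ‖ψ x‖ₑ ^ (2 : ℝ≥0∞).toReal) ?_ ?_ ?_ ?_
    · exact Eventually.of_forall fun R =>
        (((h.1.indicator measurableSet_Ioc).sub h.1).enorm).pow_const _
    · refine Eventually.of_forall fun R => ae_of_all _ fun x => ?_
      by_cases hx : x ∈ Ioc (-R) R <;> simp [hx]
    · exact (lintegral_rpow_enorm_lt_top_of_eLpNorm_lt_top hne hnt h.2).ne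
    · refine ae_of_all _ fun x => ?_
      refine tendsto_const_nhds.congr' ?_
      filter_upwards [eventually_gt_atTop |x|] with R hR
      have hx : x ∈ Ioc (-R) R := ⟨(abs_lt.1 hR).1, (abs_lt.1 hR).2.le⟩
      simp [hx]
  have := hlim.ennrpow_const (1 / (2 : ℝ≥0∞).toReal)
  simpa using this

/-- The kernel of `𝓕` is `e^{-2πixξ}`; the frequency `ξ = -t / (2π)` turns it into `e^{itx}`. -/
theorem intervalIntegral_exp_mul_eq_fourier (ψ : ℝ → ℂ) {R : ℝ} (hR : 0 ≤ R) (t : ℝ) :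
    ∫ x in (-R)..R, Complex.exp (t * x * Complex.I) * ψ x =
      𝓕 ((Ioc (-R) R).indicator ψ) ((-(2 * Real.pi))⁻¹ * t) := by
  rw [Real.fourier_real_eq_integral_exp_smul, intervalIntegral.integral_of_le (by linarith),
    ← integral_indicator measurableSet_Ioc]
  refine integral_congr_ae (ae_of_all _ fun x => ?_)
  by_cases hx : x ∈ Ioc (-R) R
  · have hπ : -2 * Real.pi * x * ((-(2 * Real.pi))⁻¹ * t) = t * x := by
      field_simp [Real.pi_ne_zero]
    simp only [hx, indicator_of_mem, smul_eq_mul]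
    rw [hπ]
    push_cast
    rfl
  · simp [hx]

/-- Plancherel: the truncated Fourier integrals of an `L²` function converge in `L²`. -/
theorem exists_tendsto_eLpNorm_truncated_fourier {ψ : ℝ → ℂ} (h : MemLp ψ 2) :
    ∃ G : ℝ → ℂ, MemLp G 2 ∧ Tendsto (fun R : ℝ => eLpNorm
      (fun t : ℝ => G t - ∫ x in (-R)..R, Complex.exp (t * x * Complex.I) * ψ x) 2 volume)
      atTop (𝓝 0) := by
  set b : ℝ := (-(2 * Real.pi))⁻¹ with hb
  have hb0 : b ≠ 0 := by
    rw [hb]; exact inv_ne_zero (neg_ne_zero.2 (by positivity))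
  have hscale : ∀ H : ℝ → ℂ, AEStronglyMeasurable H →
      eLpNorm (fun t => H (b * t)) 2 volume =
        ENNReal.ofReal |b⁻¹| ^ (1 / (2 : ℝ≥0∞)).toReal • eLpNorm H 2 volume := by
    intro H hH
    rw [← eLpNorm_smul_measure_of_ne_top (by norm_num), ← Real.map_volume_mul_left hb0,
      eLpNorm_map_measure _ (measurable_const_mul b).aemeasurable]
    · rfl
    · rw [Real.map_volume_mul_left hb0]; exact hH.smul_measure _
  have hqmp : Measure.QuasiMeasurePreserving (fun t : ℝ => b * t) volume volume :=
    ⟨measurable_const_mul b, by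
      rw [Real.map_volume_mul_left hb0]; exact Measure.smul_absolutelyContinuous⟩
  set F : Lp ℂ 2 (volume : Measure ℝ) := 𝓕 (h.toLp ψ) with hF
  refine ⟨fun t => F (b * t), ⟨(Lp.aestronglyMeasurable F).comp_quasiMeasurePreserving hqmp, ?_⟩,
    ?_⟩
  · rw [hscale _ (Lp.aestronglyMeasurable F)]
    exact ENNReal.mul_lt_top (ENNReal.rpow_lt_top_of_nonneg (by positivity) (by simp))
      (Lp.memLp F).2
  · have hind : ∀ R : ℝ, MemLp ((Ioc (-R) R).indicator ψ) 2 :=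
      fun R => h.indicator measurableSet_Ioc
    have hint : ∀ R : ℝ, Integrable ((Ioc (-R) R).indicator ψ) := fun R => by
      rw [integrable_indicator_iff measurableSet_Ioc]
      exact (h.locallyIntegrable (by norm_num)).integrableOn_isCompact isCompact_Icc |>.mono_set
        Ioc_subset_Icc_self
    have hconv : Tendsto (fun R : ℝ => ENNReal.ofReal |b⁻¹| ^ (1 / (2 : ℝ≥0∞)).toReal •
        eLpNorm ((Ioc (-R) R).indicator ψ - ψ) 2 volume) atTop (𝓝 0) := by
      have := ENNReal.Tendsto.const_mul (a := ENNReal.ofReal |b⁻¹| ^ (1 / (2 : ℝ≥0∞)).toReal)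
        (tendsto_eLpNorm_indicator_sub h)
        (Or.inr (ENNReal.rpow_lt_top_of_nonneg (by positivity) (by simp)).ne)
      simpa only [mul_zero, smul_eq_mul] using this
    refine hconv.congr' ?_
    filter_upwards [eventually_ge_atTop 0] with R hR
    set FR : Lp ℂ 2 (volume : Measure ℝ) := 𝓕 ((hind R).toLp _) with hFR
    have e1 : eLpNorm (fun t : ℝ => F (b * t) -
        ∫ x in (-R)..R, Complex.exp (t * x * Complex.I) * ψ x) 2 volume =
        eLpNorm (fun t : ℝ => (fun s => F s - FR s) (b * t)) 2 volume := by
      refine eLpNorm_congr_ae ?_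
      filter_upwards [hqmp.ae (fourier_toLp_ae_eq (hint R) (hind R))] with t ht
      rw [intervalIntegral_exp_mul_eq_fourier ψ hR t, ← ht]
    rw [e1, hscale (fun s => F s - FR s) ((Lp.aestronglyMeasurable F).sub (Lp.aestronglyMeasurable FR))]
    congr 1
    have e2 : eLpNorm (fun s => F s - FR s) 2 volume = eLpNorm (F - FR : Lp ℂ 2 volume) 2 volume :=
      eLpNorm_congr_ae (Lp.coeFn_sub F FR).symm
    -- By linearity and the isometry of `𝓕`, the error is, up to scaling, the `L²` norm of the tail
    -- of `ψ`.
    have e3 : F - FR = 𝓕 (h.toLp ψ - (hind R).toLp _) := by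
      rw [hF, hFR]
      exact ((Lp.fourierTransformₗᵢ ℝ ℂ).map_sub _ _).symm
    rw [e2, ← Lp.enorm_def, e3, ← ofReal_norm, Lp.norm_fourier_eq, ofReal_norm,
      ← MemLp.toLp_sub, Lp.enorm_toLp, eLpNorm_sub_comm]

end Plancherel

/-! ### The substitution `r = e^x` and existence of Mellin transforms. -/

theorem exp_image_univ : Real.exp '' univ = Ioi 0 := by
  rw [image_univ, Real.range_exp]

theorem exp_image_Ioc (x y : ℝ) : Real.exp '' Ioc x y = Ioc (Real.exp x) (Real.exp y) := by
  ext r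
  constructor
  · rintro ⟨s, hs, rfl⟩
    exact ⟨Real.exp_lt_exp.2 hs.1, Real.exp_le_exp.2 hs.2⟩
  · intro hr
    have hr0 : 0 < r := (Real.exp_pos x).trans hr.1
    exact ⟨Real.log r, ⟨(Real.lt_log_iff_exp_lt hr0).2 hr.1, (Real.log_le_iff_le_exp hr0).2 hr.2⟩,
      Real.exp_log hr0⟩

/-- The `X^p_c` norm of `φ` is the `L^p(ℝ)` norm of `x ↦ e^{cx} φ(e^x)`. -/
theorem normX_eq_eLpNorm_exp {p : ℝ} (hp : 0 < p) (c : ℝ) (φ : ℝ → ℂ) :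
    normX p c φ = eLpNorm (fun x : ℝ => (Real.exp (c * x) : ℂ) * φ (Real.exp x))
      (ENNReal.ofReal p) volume := by
  have hp0 : ENNReal.ofReal p ≠ 0 := by simpa using hp
  rw [normX, eLpNorm_eq_lintegral_rpow_enorm_toReal hp0 ENNReal.ofReal_ne_top,
    eLpNorm_eq_lintegral_rpow_enorm_toReal hp0 ENNReal.ofReal_ne_top,
    ENNReal.toReal_ofReal hp.le, ← exp_image_univ,
    lintegral_image_eq_lintegral_abs_deriv_mul MeasurableSet.univ
      (fun x _ => (Real.hasDerivAt_exp x).hasDerivWithinAt) Real.exp_injective.injOn,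
    Measure.restrict_univ]
  congr 1
  refine lintegral_congr fun x => ?_
  simp only [weighted, enorm_mul, ENNReal.mul_rpow_of_nonneg _ _ hp.le]
  rw [← mul_assoc]
  congr 1
  have h1 : ∀ s : ℝ, 0 < s → ‖(s : ℂ)‖ₑ = ENNReal.ofReal s := fun s hs => by
    rw [← ofReal_norm, Complex.norm_real, Real.norm_of_nonneg hs.le]
  rw [h1 _ (Real.rpow_pos_of_pos (Real.exp_pos x) _), h1 _ (Real.exp_pos _),
    ENNReal.ofReal_rpow_of_nonneg (Real.rpow_nonneg (Real.exp_pos x).le _) hp.le,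
    ENNReal.ofReal_rpow_of_nonneg (Real.exp_pos _).le hp.le,
    ← ENNReal.ofReal_mul (abs_nonneg _), abs_of_pos (Real.exp_pos x), ← Real.exp_mul,
    ← Real.exp_mul, ← Real.exp_mul, ← Real.exp_add]
  congr 2
  field_simp
  ring

theorem truncMellin_exp (c : ℝ) (φ : ℝ → ℂ) {R : ℝ} (hR : 0 ≤ R) (t : ℝ) :
    truncMellin c φ (Real.exp R) t = ∫ x in (-R)..R,
      Complex.exp (t * x * Complex.I) * ((Real.exp (c * x) : ℂ) * φ (Real.exp x)) := by
  have hle : 1 / Real.exp R ≤ Real.exp R := by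
    rw [one_div, ← Real.exp_neg]; exact Real.exp_le_exp.2 (by linarith)
  rw [truncMellin, intervalIntegral.integral_of_le hle,
    intervalIntegral.integral_of_le (by linarith), one_div, ← Real.exp_neg, ← exp_image_Ioc,
    integral_image_eq_integral_abs_deriv_smul measurableSet_Ioc
      (fun x _ => (Real.hasDerivAt_exp x).hasDerivWithinAt) Real.exp_injective.injOn]
  refine integral_congr_ae (ae_of_all _ fun x => ?_)
  simp only [abs_of_pos (Real.exp_pos x), Complex.real_smul]
  rw [← mul_assoc, ← mul_assoc]
  congr 1
  rw [Complex.cpow_def_of_ne_zero (by exact_mod_cast (Real.exp_pos x).ne'),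
    ← Complex.ofReal_log (Real.exp_pos x).le, Real.log_exp, Complex.ofReal_exp, Complex.ofReal_exp,
    ← Complex.exp_add, ← Complex.exp_add]
  congr 1
  push_cast
  ring

theorem continuous_comp_exp {φ : ℝ → ℂ} (hφ : ContinuousOn φ (Ioi 0)) :
    Continuous fun x => φ (Real.exp x) :=
  hφ.comp_continuous Real.continuous_exp fun x => Real.exp_pos x

theorem exists_isMellinTransform {p : ℝ} (hp : p = 1 ∨ p = 2) {c : ℝ} {φ : ℝ → ℂ}
    (hφ : ContinuousOn φ (Ioi 0)) (h : MemX p c φ) : ∃ G, IsMellinTransform p c φ G := by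
  rcases hp with rfl | rfl
  · refine ⟨fun t => mellin φ (c + t * Complex.I), ?_⟩
    rw [IsMellinTransform, if_pos rfl]
    refine fun t => ⟨?_, rfl⟩
    rw [MellinConvergent, mellin_convergent_iff_norm subset_rfl measurableSet_Ioi
      (hφ.aestronglyMeasurable measurableSet_Ioi)]
    rw [MemX, ENNReal.ofReal_one, memLp_one_iff_integrable] at h
    refine h.norm.congr ?_
    filter_upwards [ae_restrict_mem measurableSet_Ioi] with r hr
    rw [weighted, norm_mul, Complex.norm_real,
      Real.norm_of_nonneg (Real.rpow_nonneg (le_of_lt hr) _)]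
    simp
  · have hψ : MemLp (fun x : ℝ => (Real.exp (c * x) : ℂ) * φ (Real.exp x)) 2 := by
      refine ⟨?_, ?_⟩
      ·       exact (Continuous.mul (by fun_prop) (continuous_comp_exp hφ)).aestronglyMeasurable
      · have h2 := normX_eq_eLpNorm_exp (two_pos) c φ
        rw [ENNReal.ofReal_ofNat] at h2
        rw [← h2]
        exact h.2
    obtain ⟨G, hG, hlim⟩ := exists_tendsto_eLpNorm_truncated_fourier hψ
    refine ⟨G, ?_⟩
    have h22 : ENNReal.ofReal ((2 : ℝ) / (2 - 1)) = 2 := by norm_num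
    rw [IsMellinTransform, if_neg (by norm_num), h22]
    refine ⟨hG, (hlim.comp Real.tendsto_log_atTop).congr' ?_⟩
    filter_upwards [eventually_ge_atTop 1] with ρ hρ
    refine congrArg (fun F => eLpNorm F 2 volume) (funext fun t => ?_)
    rw [← truncMellin_exp c φ (Real.log_nonneg hρ), Real.exp_log (by linarith)]

theorem isMellinTransform_mellinTransform {p : ℝ} (hp : p = 1 ∨ p = 2) {c : ℝ} {φ : ℝ → ℂ}
    (hφ : ContinuousOn φ (Ioi 0)) (h : MemX p c φ) :
    IsMellinTransform p c φ (mellinTransform p c φ) :=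
  Classical.epsilon_spec (exists_isMellinTransform hp hφ h)

/-- Along a subsequence, the truncated Mellin integrals converge almost everywhere to the Mellin
transform. -/
theorem IsMellinTransform.exists_subseq_tendsto {p : ℝ} (hp : p = 1 ∨ p = 2) {c : ℝ}
    {φ G : ℝ → ℂ} (hφ : ContinuousOn φ (Ioi 0)) (h : IsMellinTransform p c φ G) {R : ℕ → ℝ}
    (hR0 : ∀ n, 0 ≤ R n) (hR : Tendsto R atTop atTop) :
    ∃ ns : ℕ → ℕ, StrictMono ns ∧ ∀ᵐ t : ℝ,
      Tendsto (fun n => truncMellin c φ (Real.exp (R (ns n))) t) atTop (𝓝 (G t)) := by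
  have hρ : Tendsto (fun n => Real.exp (R n)) atTop atTop := Real.tendsto_exp_atTop.comp hR
  rcases hp with rfl | rfl
  · rw [IsMellinTransform, if_pos rfl] at h
    refine ⟨id, strictMono_id, ae_of_all _ fun t => ?_⟩
    obtain ⟨hc, hG⟩ := h t
    rw [hG, mellin]
    have hcov : AECover (volume.restrict (Ioi (0 : ℝ))) atTop
        (fun n => Ioc (1 / Real.exp (R n)) (Real.exp (R n))) :=
      (aecover_Ioi_of_Ioi (by simp only [one_div]; exact hρ.inv_tendsto_atTop)).inter
        ((aecover_Iic hρ).mono Measure.restrict_le_self)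
    refine (hcov.integral_tendsto_of_countably_generated hc).congr fun n => ?_
    have hle : 1 / Real.exp (R n) ≤ Real.exp (R n) := by
      rw [one_div, ← Real.exp_neg]; exact Real.exp_le_exp.2 (by linarith [hR0 n])
    have hpos : 0 ≤ 1 / Real.exp (R n) := (one_div_pos.2 (Real.exp_pos _)).le
    have hsub : Ioc (1 / Real.exp (R n)) (Real.exp (R n)) ⊆ Ioi 0 :=
      fun x hx => lt_of_le_of_lt hpos hx.1
    rw [Measure.restrict_restrict_of_subset hsub]
    exact (intervalIntegral.integral_of_le hle).symm
  · have h22 : ENNReal.ofReal ((2 : ℝ) / (2 - 1)) = 2 := by norm_num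
    rw [IsMellinTransform, if_neg (by norm_num), h22] at h
    -- `L²` convergence gives convergence in measure, hence almost everywhere along a subsequence.
    refine (tendstoInMeasure_of_tendsto_eLpNorm (p := 2) (by norm_num) (fun n => ?_) h.1.1
      ((h.2.comp hρ).congr fun n => eLpNorm_sub_comm _ _ _ _)).exists_seq_tendsto_ae
    rw [funext (truncMellin_exp c φ (hR0 n))]
    refine (intervalIntegral.continuous_parametric_intervalIntegral_of_continuous'
      ?_ _ _).aestronglyMeasurable
    exact Continuous.mul (by fun_prop) (Continuous.mul (by fun_prop)
      ((continuous_comp_exp hφ).comp continuous_snd))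

/-! ### Shifting the line of integration. -/

/-- A nonnegative function on `ℝ` with finite integral tends to zero along a sequence tending to
`∞`. -/
theorem exists_seq_tendsto_zero_of_lintegral_ne_top {N : ℝ → ℝ≥0∞} (h : ∫⁻ x, N x ≠ ⊤) :
    ∃ R : ℕ → ℝ, (∀ n, 0 ≤ R n) ∧ Tendsto R atTop atTop ∧
      Tendsto (fun n => N (R n)) atTop (𝓝 0) := by
  have key : ∀ n : ℕ, ∃ x : ℝ, (n : ℝ) ≤ x ∧ N x ≤ ((n : ℝ≥0∞) + 1)⁻¹ := by
    intro n
    -- Otherwise `N` exceeds a positive constant on a half-line, and its integral is infinite.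
    by_contra! hcon
    refine h (top_unique ?_)
    have hpos : ((n : ℝ≥0∞) + 1)⁻¹ ≠ 0 := ENNReal.inv_ne_zero.2 (by finiteness)
    calc (⊤ : ℝ≥0∞) = ∫⁻ _ in Ici (n : ℝ), ((n : ℝ≥0∞) + 1)⁻¹ := by
          rw [setLIntegral_const, Real.volume_Ici, ENNReal.mul_top hpos]
      _ ≤ ∫⁻ x in Ici (n : ℝ), N x := setLIntegral_mono' measurableSet_Ici
          fun x hx => (hcon x hx).le
      _ ≤ ∫⁻ x, N x := setLIntegral_le_lintegral _ _
  choose R hR1 hR2 using key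
  refine ⟨R, fun n => (Nat.cast_nonneg n).trans (hR1 n),
    tendsto_atTop_mono hR1 tendsto_natCast_atTop_atTop, ?_⟩
  refine tendsto_of_tendsto_of_tendsto_of_le_of_le tendsto_const_nhds ?_ (fun _ => zero_le) hR2
  have := ENNReal.tendsto_inv_nat_nhds_zero.comp (tendsto_add_atTop_nat 1)
  refine this.congr fun n => ?_
  simp

/-- If `H` is continuous on a strip and its `p`-th power means along horizontal lines are bounded,
then the integrals of `‖H‖` over the vertical segments at `± R n` tend to zero for some sequence
`R n → ∞`. -/
theorem exists_seq_tendsto_vertical_lintegral {p : ℝ} (hp : 1 ≤ p) {a θ : ℝ}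
    (hθ : θ ∈ Ioo (-a) a) {H : ℂ → ℂ} (hH : ContinuousOn H {z | z.im ∈ Ioo (-a) a}) {K : ℝ≥0∞}
    (hK : K ≠ ⊤) (hb : ∀ y ∈ Ioo (-a) a, ∫⁻ x : ℝ, ‖H (x + y * Complex.I)‖ₑ ^ p ≤ K) :
    ∃ R : ℕ → ℝ, (∀ n, 0 ≤ R n) ∧ Tendsto R atTop atTop ∧
      Tendsto (fun n => ∫⁻ y : ℝ in uIoc 0 θ, ‖H (R n + y * Complex.I)‖ₑ) atTop (𝓝 0) ∧
      Tendsto (fun n => ∫⁻ y : ℝ in uIoc 0 θ, ‖H (-R n + y * Complex.I)‖ₑ) atTop (𝓝 0) := by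
  have hp0 : 0 < p := by linarith
  have h0 : (0 : ℝ) ∈ Ioo (-a) a := by
    have := hθ.1; have := hθ.2; constructor <;> linarith
  have hsub : uIoc 0 θ ⊆ Ioo (-a) a :=
    uIoc_subset_uIcc.trans (ordConnected_Ioo.uIcc_subset h0 hθ)
  have hcont : ContinuousOn (fun q : ℝ × ℝ => H (q.1 + q.2 * Complex.I)) (univ ×ˢ uIoc 0 θ) := by
    refine hH.comp (by fun_prop) fun q hq => ?_
    simpa using hsub hq.2
  have hmeas : AEMeasurable (fun q : ℝ × ℝ => ‖H (q.1 + q.2 * Complex.I)‖ₑ ^ p)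
      ((volume : Measure ℝ).prod (volume.restrict (uIoc 0 θ))) := by
    have := hcont.aestronglyMeasurable (μ := (volume : Measure ℝ).prod (volume : Measure ℝ))
      (MeasurableSet.univ.prod measurableSet_uIoc)
    rw [← Measure.prod_restrict, Measure.restrict_univ] at this
    exact this.enorm.pow_const p
  set N : ℝ → ℝ≥0∞ := fun x => ∫⁻ y : ℝ in uIoc 0 θ, ‖H (x + y * Complex.I)‖ₑ ^ p with hN
  have hvol : volume (uIoc 0 θ) ≠ ⊤ := by simp [uIoc]
  have hNmeas : AEMeasurable N := hmeas.lintegral_prod_right'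
  have hNfin : ∫⁻ x, N x ≠ ⊤ := by
    rw [hN, lintegral_lintegral_swap hmeas]
    refine ne_top_of_le_ne_top (ENNReal.mul_ne_top hK hvol) ?_
    rw [← setLIntegral_const]
    exact setLIntegral_mono' measurableSet_uIoc fun y hy => hb y (hsub hy)
  have hneg : ∫⁻ x, N (-x) = ∫⁻ x, N x := lintegral_neg_eq_self N
  -- Summing `N x` and `N (-x)` yields one sequence that serves both vertical sides.
  obtain ⟨R, hR0, hR, hlim⟩ := exists_seq_tendsto_zero_of_lintegral_ne_top
    (N := fun x => N x + N (-x)) (by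
      rw [lintegral_add_left' hNmeas, hneg]
      exact ENNReal.add_ne_top.2 ⟨hNfin, hNfin⟩)
  have hle : ∀ x : ℝ, ∫⁻ y : ℝ in uIoc 0 θ, ‖H (x + y * Complex.I)‖ₑ ≤
      N x ^ (1 / p) * volume (uIoc 0 θ) ^ (1 - 1 / p) := by
    intro x
    have hm : AEStronglyMeasurable (fun y : ℝ => H (x + y * Complex.I))
        (volume.restrict (uIoc 0 θ)) := by
      refine ContinuousOn.aestronglyMeasurable ?_ measurableSet_uIoc
      refine hH.comp (by fun_prop) fun y hy => ?_
      simpa using hsub hy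
    -- Hölder on a segment of finite length passes from exponent `p` to `1`.
    have := eLpNorm_le_eLpNorm_mul_rpow_measure_univ (p := 1) (q := ENNReal.ofReal p)
      (by simpa using hp) hm
    rwa [eLpNorm_one_eq_lintegral_enorm, eLpNorm_eq_lintegral_rpow_enorm_toReal (by simpa using hp0)
      ENNReal.ofReal_ne_top, ENNReal.toReal_ofReal hp0.le, Measure.restrict_apply_univ,
      ENNReal.toReal_one, div_one] at this
  have hz : ∀ s : ℕ → ℝ, Tendsto (fun n => N (s n)) atTop (𝓝 0) →
      Tendsto (fun n => ∫⁻ y : ℝ in uIoc 0 θ, ‖H (s n + y * Complex.I)‖ₑ) atTop (𝓝 0) := by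
    intro s hs
    refine tendsto_of_tendsto_of_tendsto_of_le_of_le tendsto_const_nhds ?_ (fun _ => zero_le)
      (fun n => hle (s n))
    have h1 := ENNReal.Tendsto.mul_const (b := volume (uIoc 0 θ) ^ (1 - 1 / p))
      (hs.ennrpow_const (1 / p)) (Or.inr (ENNReal.rpow_ne_top_of_nonneg
        (sub_nonneg.2 ((div_le_one hp0).2 hp)) hvol))
    rwa [ENNReal.zero_rpow_of_pos (by positivity), zero_mul] at h1
  refine ⟨R, hR0, hR, hz R ?_, ?_⟩
  · exact tendsto_of_tendsto_of_tendsto_of_le_of_le tendsto_const_nhds hlim (fun _ => zero_le)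
      (fun n => le_self_add)
  · have := hz (fun n => -R n) (tendsto_of_tendsto_of_tendsto_of_le_of_le tendsto_const_nhds hlim
      (fun _ => zero_le) (fun n => le_add_self))
    simpa using this

/-- Shifting the line of integration of `e^{itz} H(z)`, `H` holomorphic on a strip, when the
integrals over the vertical segments tend to zero. -/
theorem tendsto_integral_sub_integral_shift {a θ : ℝ} (hθ : θ ∈ Ioo (-a) a) {H : ℂ → ℂ}
    (hH : DifferentiableOn ℂ H {z | z.im ∈ Ioo (-a) a}) {R : ℕ → ℝ}
    (h1 : Tendsto (fun n => ∫⁻ y : ℝ in uIoc 0 θ, ‖H (R n + y * Complex.I)‖ₑ) atTop (𝓝 0))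
    (h2 : Tendsto (fun n => ∫⁻ y : ℝ in uIoc 0 θ, ‖H (-R n + y * Complex.I)‖ₑ) atTop (𝓝 0)) (t : ℝ) :
    Tendsto (fun n => (∫ x in (-R n)..R n, Complex.exp (t * x * Complex.I) * H x) -
      ∫ x in (-R n)..R n, Complex.exp (t * (x + θ * Complex.I) * Complex.I) *
        H (x + θ * Complex.I)) atTop (𝓝 0) := by
  have h0 : (0 : ℝ) ∈ Ioo (-a) a := by
    have := hθ.1; have := hθ.2; constructor <;> linarith
  have hvert : ∀ s : ℕ → ℝ,
      Tendsto (fun n => ∫⁻ y : ℝ in uIoc 0 θ, ‖H (s n + y * Complex.I)‖ₑ) atTop (𝓝 0) →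
      Tendsto (fun n => ∫ y in (0 : ℝ)..θ, Complex.exp (t * (s n + y * Complex.I) * Complex.I) *
        H (s n + y * Complex.I)) atTop (𝓝 0) := by
    intro s hs
    rw [tendsto_zero_iff_norm_tendsto_zero]
    have hC := ENNReal.Tendsto.const_mul (a := ENNReal.ofReal (Real.exp (|t| * |θ|))) hs
      (Or.inr ENNReal.ofReal_ne_top)
    rw [mul_zero] at hC
    have hC' := (ENNReal.tendsto_toReal ENNReal.zero_ne_top).comp hC
    rw [ENNReal.toReal_zero] at hC'
    -- `toReal` sends `⊤` to `0`, so its monotonicity needs a finite bound, available for large `n`.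
    have hfin := (ENNReal.tendsto_nhds_zero.1 hC) 1 one_pos
    refine tendsto_of_tendsto_of_tendsto_of_le_of_le' tendsto_const_nhds hC'
      (Eventually.of_forall fun _ => norm_nonneg _) ?_
    filter_upwards [hfin] with n hn
    rw [intervalIntegral.norm_intervalIntegral_eq, ← toReal_enorm]
    refine ENNReal.toReal_mono (ne_top_of_le_ne_top ENNReal.one_ne_top hn) ?_
    refine (enorm_integral_le_lintegral_enorm _).trans ?_
    beta_reduce
    rw [← lintegral_const_mul' _ _ ENNReal.ofReal_ne_top]
    refine setLIntegral_mono' measurableSet_uIoc fun y hy => ?_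
    rw [enorm_mul]
    gcongr
    rw [← ofReal_norm, Complex.norm_exp]
    refine ENNReal.ofReal_le_ofReal (Real.exp_le_exp.2 ?_)
    have hy' : |y| ≤ |θ| := by
      have := abs_sub_left_of_mem_uIcc (uIoc_subset_uIcc hy)
      simpa using this
    have : (t * (s n + y * Complex.I) * Complex.I : ℂ).re = -(t * y) := by
      simp
    rw [this]
    calc -(t * y) ≤ |t * y| := neg_le_abs _
      _ = |t| * |y| := abs_mul _ _
      _ ≤ |t| * |θ| := by gcongr
  have hdiff : DifferentiableOn ℂ (fun z => Complex.exp (t * z * Complex.I) * H z)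
      {z | z.im ∈ Ioo (-a) a} := DifferentiableOn.mul (by fun_prop) hH
  have hrect : ∀ n, (∫ x in (-R n)..R n, Complex.exp (t * x * Complex.I) * H x) -
      (∫ x in (-R n)..R n, Complex.exp (t * (x + θ * Complex.I) * Complex.I) *
        H (x + θ * Complex.I)) =
      Complex.I * (∫ y in (0 : ℝ)..θ, Complex.exp (t * ((-R n : ℝ) + y * Complex.I) * Complex.I) *
        H ((-R n : ℝ) + y * Complex.I)) -
      Complex.I * (∫ y in (0 : ℝ)..θ, Complex.exp (t * (R n + y * Complex.I) * Complex.I) *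
        H (R n + y * Complex.I)) := by
    intro n
    have := Complex.integral_boundary_rect_eq_zero_of_differentiableOn
      (fun z => Complex.exp (t * z * Complex.I) * H z) ⟨-R n, 0⟩ ⟨R n, θ⟩
      (hdiff.mono fun z hz => ordConnected_Ioo.uIcc_subset h0 hθ hz.2)
    simp only [Complex.ofReal_zero, zero_mul, add_zero, smul_eq_mul] at this
    linear_combination this
  simp only [hrect]
  have hl := (hvert (fun n => -R n) (by simpa using h2)).const_mul Complex.I
  have hr := (hvert R h1).const_mul Complex.I
  simpa only [mul_zero, sub_zero] using hl.sub hr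

/-! ### Polar-analytic and Hardy functions in logarithmic coordinates. -/

theorem polar_exp_re_im (z : ℂ) : polar (Real.exp z.re, z.im) = Complex.exp z := by
  rw [polar, Complex.ofReal_exp, ← Complex.exp_add, Complex.re_add_im]

/-- In logarithmic coordinates a polar-analytic function is holomorphic. -/
theorem PolarAnalyticOn.differentiableOn {a : ℝ} {f : ℝ × ℝ → ℂ}
    (hf : PolarAnalyticOn f (strip a)) :
    DifferentiableOn ℂ (fun z : ℂ => f (Real.exp z.re, z.im)) {z | z.im ∈ Ioo (-a) a} := by
  intro z₀ hz₀
  obtain ⟨L, hL⟩ := hf (Real.exp z₀.re, z₀.im) ⟨Real.exp_pos _, hz₀⟩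
  have hq : Tendsto (fun z : ℂ => (Real.exp z.re, z.im)) (𝓝[≠] z₀)
      (𝓝[strip a \ {(Real.exp z₀.re, z₀.im)}] (Real.exp z₀.re, z₀.im)) := by
    refine tendsto_nhdsWithin_iff.2 ⟨?_, ?_⟩
    · have : Continuous (fun z : ℂ => (Real.exp z.re, z.im)) := by fun_prop
      exact this.continuousAt.tendsto.mono_left nhdsWithin_le_nhds
    · have hopen : ∀ᶠ z : ℂ in 𝓝[≠] z₀, z.im ∈ Ioo (-a) a :=
        nhdsWithin_le_nhds (Complex.continuous_im.continuousAt (isOpen_Ioo.mem_nhds hz₀))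
      filter_upwards [hopen, self_mem_nhdsWithin] with z hz hne
      refine ⟨⟨Real.exp_pos _, hz⟩, fun h => hne ?_⟩
      have h' := Prod.mk.inj h
      exact Complex.ext (Real.exp_injective h'.1) h'.2
  have hexp := Complex.hasDerivAt_exp z₀
  have hderiv : HasDerivAt (fun z : ℂ => f (Real.exp z.re, z.im)) (L * Complex.exp z₀) z₀ := by
    rw [hasDerivAt_iff_tendsto_slope] at hexp ⊢
    refine ((hL.comp hq).mul hexp).congr' ?_
    -- The slope is the polar quotient times the slope of `exp`; cancelling needs `e^z ≠ e^{z₀}`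
    -- near `z₀`, true because `exp' ≠ 0`.
    filter_upwards [(Complex.hasDerivAt_exp z₀).eventually_ne (c := Complex.exp z₀)
      (Complex.exp_ne_zero z₀)] with z hz
    simp only [Function.comp_apply, polar_exp_re_im, slope_def_field]
    have := sub_ne_zero.2 hz
    field_simp
  exact hderiv.differentiableAt.differentiableWithinAt

theorem PolarAnalyticOn.continuousOn_slice {a : ℝ} {f : ℝ × ℝ → ℂ}
    (hf : PolarAnalyticOn f (strip a)) {θ : ℝ} (hθ : θ ∈ Ioo (-a) a) :
    ContinuousOn (fun r => f (r, θ)) (Ioi 0) := by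
  have hlog : ContinuousOn (fun r : ℝ => (⟨Real.log r, θ⟩ : ℂ)) (Ioi 0) := by
    have : ContinuousOn (fun r : ℝ => (Real.log r : ℂ) + θ * Complex.I) (Ioi 0) :=
      (Complex.continuous_ofReal.comp_continuousOn
        (Real.continuousOn_log.mono fun r hr => (ne_of_gt hr))).add continuousOn_const
    refine this.congr fun r _ => ?_
    exact (Complex.mk_eq_add_mul_I _ _)
  refine (hf.differentiableOn.continuousOn.comp hlog fun r _ => hθ).congr fun r hr => ?_
  simp only [Function.comp_apply, Real.exp_log hr]

/-- The `X^p_c` norms of the slices of a function of `H^p_c(ℍ_a)` are uniformly bounded. -/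
theorem MemHardy.exists_normX_rpow_le {p c a : ℝ} (hp : 0 < p) (ha : 0 < a) {f : ℝ × ℝ → ℂ}
    (hf : MemHardy p c a f) : ∃ K : ℝ≥0∞, K ≠ ⊤ ∧
      ∀ θ ∈ Ioo (-a) a, normX p c (fun r => f (r, θ)) ^ p ≤ K := by
  set M := hardyNorm p c a f with hM
  have hpos : ∀ θ ∈ Ioo (0 : ℝ) a,
      normX p c (fun r => f (r, θ)) ^ p + normX p c (fun r => f (r, -θ)) ^ p ≤ M ^ p * 2 := by
    intro θ hθ
    have h1 : ((normX p c (fun r => f (r, θ)) ^ p +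
        normX p c (fun r => f (r, -θ)) ^ p) / 2) ^ (1 / p) ≤ M :=
      le_iSup₂_of_le (f := fun θ (_ : θ ∈ Ioo (0 : ℝ) a) => ((normX p c (fun r => f (r, θ)) ^ p +
        normX p c (fun r => f (r, -θ)) ^ p) / 2) ^ (1 / p)) θ hθ le_rfl
    rw [one_div, ENNReal.rpow_inv_le_iff hp] at h1
    exact (ENNReal.div_le_iff_le_mul (Or.inl two_ne_zero) (Or.inl (by simp))).1 h1
  -- The Hardy norm only sees `θ ≠ 0`, so the slice `θ = 0` is added separately.
  refine ⟨M ^ p * 2 + normX p c (fun r => f (r, 0)) ^ p, ?_, fun θ hθ => ?_⟩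
  · have h1 : M ^ p ≠ ⊤ := ENNReal.rpow_ne_top_of_nonneg hp.le hf.norm_lt_top.ne
    have h2 : normX p c (fun r => f (r, 0)) ^ p ≠ ⊤ :=
      ENNReal.rpow_ne_top_of_nonneg hp.le (hf.memX 0 ⟨by linarith, ha⟩).2.ne
    finiteness
  · rcases lt_trichotomy θ 0 with h | rfl | h
    · have := hpos (-θ) ⟨by linarith, by linarith [hθ.1]⟩
      rw [neg_neg] at this
      exact (le_add_self.trans this).trans le_self_add
    · exact le_add_self
    · exact (le_self_add.trans (hpos θ ⟨h, hθ.2⟩)).trans le_self_add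

/-- The Mellin transforms of two slices of a function of `H^p_c(ℍ_a)` differ by the factor
`e^{(ic - t)θ}`. -/
theorem MemHardy.ae_mellin_zero_eq {p c a : ℝ} (hp : p = 1 ∨ p = 2) {f : ℝ × ℝ → ℂ}
    (hf : MemHardy p c a f) {θ : ℝ} (hθ : θ ∈ Ioo (-a) a) {G₀ G : ℝ → ℂ}
    (hG₀ : IsMellinTransform p c (fun r => f (r, 0)) G₀)
    (hG : IsMellinTransform p c (fun r => f (r, θ)) G) :
    ∀ᵐ t : ℝ, G₀ t = Complex.exp ((c * Complex.I - t) * θ) * G t := by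
  have hp1 : 1 ≤ p := by rcases hp with rfl | rfl <;> norm_num
  have hp0 : 0 < p := by linarith
  have h0 : (0 : ℝ) ∈ Ioo (-a) a := by
    have := hθ.1; have := hθ.2; constructor <;> linarith
  set H : ℂ → ℂ := fun z => Complex.exp (c * z) * f (Real.exp z.re, z.im) with hH
  have hHline : ∀ x y : ℝ, H (x + y * Complex.I) =
      Complex.exp (c * y * Complex.I) * ((Real.exp (c * x) : ℂ) * f (Real.exp x, y)) := by
    intro x y
    have e : Complex.exp (c * (x + y * Complex.I)) =
        Complex.exp (c * y * Complex.I) * (Real.exp (c * x) : ℂ) := by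
      rw [Complex.ofReal_exp, ← Complex.exp_add]
      congr 1
      push_cast
      ring
    simp [hH, e, mul_assoc]
  have hdiff : DifferentiableOn ℂ H {z | z.im ∈ Ioo (-a) a} :=
    DifferentiableOn.mul (by fun_prop) hf.polarAnalytic.differentiableOn
  obtain ⟨K, hK, hKb⟩ := hf.exists_normX_rpow_le hp0 h0.2
  have hb : ∀ y ∈ Ioo (-a) a, ∫⁻ x : ℝ, ‖H (x + y * Complex.I)‖ₑ ^ p ≤ K := by
    intro y hy
    refine le_trans (le_of_eq ?_) (hKb y hy)
    rw [normX_eq_eLpNorm_exp hp0, eLpNorm_eq_lintegral_rpow_enorm_toReal (by simpa using hp0)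
      ENNReal.ofReal_ne_top, ENNReal.toReal_ofReal hp0.le, ← ENNReal.rpow_mul,
      one_div_mul_cancel hp0.ne', ENNReal.rpow_one]
    refine lintegral_congr fun x => ?_
    have e : ‖Complex.exp (c * y * Complex.I)‖ₑ = 1 := by
      rw [← ofReal_norm, ← Complex.ofReal_mul, Complex.norm_exp_ofReal_mul_I, ENNReal.ofReal_one]
    rw [hHline, enorm_mul, e, one_mul]
  obtain ⟨R, hR0, hR, hR1, hR2⟩ :=
    exists_seq_tendsto_vertical_lintegral hp1 hθ hdiff.continuousOn hK hb
  obtain ⟨n₁, hn₁, hlim₁⟩ := hG₀.exists_subseq_tendsto hp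
    (hf.polarAnalytic.continuousOn_slice h0) hR0 hR
  -- Extracted inside the first subsequence, so that both slices converge along `n₁ ∘ n₂`.
  obtain ⟨n₂, hn₂, hlim₂⟩ := hG.exists_subseq_tendsto hp
    (hf.polarAnalytic.continuousOn_slice hθ) (fun n => hR0 (n₁ n)) (hR.comp hn₁.tendsto_atTop)
  filter_upwards [hlim₁, hlim₂] with t ht₁ ht₂
  have hshift := (tendsto_integral_sub_integral_shift hθ hdiff hR1 hR2 t).comp
    (hn₁.comp hn₂).tendsto_atTop
  have hlim := (ht₁.comp hn₂.tendsto_atTop).sub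
    (ht₂.const_mul (Complex.exp ((c * Complex.I - t) * θ)))
  have heq := tendsto_nhds_unique hlim (hshift.congr fun n => ?_)
  · exact sub_eq_zero.1 heq
  · simp only [Function.comp_apply]
    rw [truncMellin_exp _ _ (hR0 _), truncMellin_exp _ _ (hR0 _),
      ← intervalIntegral.integral_const_mul]
    congr 1
    · refine intervalIntegral.integral_congr fun x _ => ?_
      have := hHline x 0
      simp only [Complex.ofReal_zero, zero_mul, add_zero, mul_zero, Complex.exp_zero, one_mul]
        at this
      simp only [this]
    · refine intervalIntegral.integral_congr fun x _ => ?_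
      simp only [hHline]
      rw [← mul_assoc, ← mul_assoc (Complex.exp ((c * Complex.I - t) * θ)), ← Complex.exp_add,
        ← Complex.exp_add]
      congr 2
      linear_combination (t * θ : ℂ) * Complex.I_sq

end MellinHardy

theorem theorem5 (p : ℝ) (hp : p = 1 ∨ p = 2) (c a : ℝ) (f : ℝ × ℝ → ℂ)
    (hf : MellinHardy.MemHardy p c a f) (α : ℝ) (hα : α ∈ Set.Ioo (0 : ℝ) a) :
    (∀ θ ∈ Set.Ioo (-a) a, MellinHardy.IsMellinTransform p c (fun r => f (r, θ))
      (MellinHardy.mellinTransform p c (fun r => f (r, θ)))) ∧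
    ∀ᵐ t : ℝ, ‖MellinHardy.mellinTransform p c (fun r => f (r, 0)) t‖ =
      Real.exp (-α * |t|) *
        ‖MellinHardy.mellinTransform p c (fun r => f (r, Real.sign t * α)) t‖ := by
  have htrans : ∀ θ ∈ Set.Ioo (-a) a, MellinHardy.IsMellinTransform p c (fun r => f (r, θ))
      (MellinHardy.mellinTransform p c (fun r => f (r, θ))) := fun θ hθ =>
    MellinHardy.isMellinTransform_mellinTransform hp (hf.polarAnalytic.continuousOn_slice hθ)
      (hf.memX θ hθ)
  have h0 : (0 : ℝ) ∈ Set.Ioo (-a) a := ⟨by linarith [hα.1, hα.2], by linarith [hα.1, hα.2]⟩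
  have hpos : α ∈ Set.Ioo (-a) a := ⟨by linarith [hα.1, hα.2], hα.2⟩
  have hneg : -α ∈ Set.Ioo (-a) a := ⟨by linarith [hα.2], by linarith [hα.1, hα.2]⟩
  have hnorm : ∀ θ t : ℝ, ‖Complex.exp ((c * Complex.I - t) * θ)‖ = Real.exp (-θ * t) := by
    intro θ t
    rw [Complex.norm_exp]
    congr 1
    simp [mul_comm]
  refine ⟨htrans, ?_⟩
  -- `Real.sign 0 = 0` selects neither `α` nor `-α`; the point `t = 0` is discarded as a null set.
  have hne : ∀ᵐ t : ℝ, t ≠ 0 := MeasureTheory.Measure.ae_ne _ 0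
  filter_upwards [hf.ae_mellin_zero_eq hp hpos (htrans 0 h0) (htrans α hpos),
    hf.ae_mellin_zero_eq hp hneg (htrans 0 h0) (htrans (-α) hneg), hne] with t h1 h2 ht
  rcases lt_or_gt_of_ne ht with h | h
  · rw [h2, norm_mul, hnorm, Real.sign_of_neg h, abs_of_neg h, neg_one_mul, neg_mul_neg, neg_neg]
  · rw [h1, norm_mul, hnorm, Real.sign_of_pos h, abs_of_pos h, one_mul]
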